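/- Let $\mathcal S$ be a second-countable topological space and $\mathcal A$ a separable metric space, both with their Borel $\sigma$-algebras. Let $p_{\mathcal D}$ be a probability measure on $\mathcal S\times\mathcal A$ (the demonstration law), with state marginal $p_{\mathcal D,S}$ and regular conditional action law $p_{\mathcal D}(\cdot\mid s)$. For each $s\in\mathcal S$ let $\mathsf K(s)\ge 1$ be an integer and let $C_1(s),\dots,C_{\mathsf K(s)}(s)\subseteq\mathcal A$ be mode sets, depending measurably on $s$, with $$\operatorname{supp}p_{\mathcal D}(\cdot\mid s)\subseteq\bigcup_{k=1}^{\mathsf K(s)}C_k(s),\qquad \min_{k\ne k'}\operatorname{dist}\bigl(C_k(s),C_{k'}(s)\bigr)>0 .$$ Let $g(a,s)=\sum_{k=1}^{\mathsf K(s)}k\,\mathbf 1_{\{a\in C_k(s)\}}$. Let $q_\phi(\cdot\mid a,s)$ (posterior encoder) and $p_\psi(\cdot\mid s)$ (conditional prior) be Markov kernels into $\mathbb R^{\mathsf d_z}$, and let the decoder be deterministic, $\pi_\theta(\cdot\mid z,s)=\delta_{f_\theta(z,s)}$ with $f_\theta:\mathbb R^{\mathsf d_z}\times\mathcal S\to\mathcal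 A$ measurable. Let $(S,A)\sim p_{\mathcal D}$, $Z\sim q_\phi(\cdot\mid A,S)$ and $M=g(A,S)$, and set $$\rho(s)=\Pr\bigl(f_\theta(Z,s)\notin C_M(s)\,\big|\,S=s\bigr),$$ where, given $S=s$, $A\sim p_{\mathcal D}(\cdot\mid s)$, $Z\sim q_\phi(\cdot\mid A,s)$ and $M=g(A,s)$. Assume $\rho(s)\le 1-1/\mathsf K(s)$ for all $s\in\operatorname{supp}(p_{\mathcal D,S})$ with $\mathsf K(s)>1$. Let $$B_\rho=\mathbb E\bigl[H(M\mid S)\bigr]-\mathbb E\bigl[H_b(\rho(S))+\rho(S)\log(\mathsf K(S)-1)\bigr],\qquad H_b(p)=-p\log p-(1-p)\log(1-p),$$ where $H(M\mid S)$ is the Shannon entropy of the conditional law of $M$ given $S$ at the observed state, the second bracket is taken to be zero when $\mathsf K(S)=1$, and the two expectations, which are in $[0,\infty]$, are not both infinite. Then the conditional mutual information satisfies $$I(A;Z\mid S)\ \ge\ B_\rho ,$$ and consequently $$\mathbb E_{(S,A)\sim p_{\mathcal D}}\,\mathrm{KL}\bigl(q_\phi(\cdot\mid A,S)\,\big\|\,p_\psi(\cdot\mid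 S)\bigr)\ \ge\ B_\rho .$$ Here informations and divergences take values in $[0,\infty]$. -/

import Mathlib

open MeasureTheory ProbabilityTheory
open scoped ENNReal

namespace ModeInfo

noncomputable section

/-! ### Information quantities (in nats) -/

/-- Shannon entropy `- ∑ p log p` of a law on a countable discrete space.  For a probability
measure every summand is nonnegative, so the sum is taken in `[0, ∞]`. -/
def shannonEntropy {X : Type*} [MeasurableSpace X] (ν : Measure X) : ℝ≥0∞ :=
  ∑' x : X, ENNReal.ofReal (Real.negMulLog (ν.real {x}))

/-- Mutual information `I(X;Y)` of a pair with joint law `ν`: the Kullback-Leibler divergence of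
the joint law from the product of its marginals. -/
def mutualInfo {X Y : Type*} [MeasurableSpace X] [MeasurableSpace Y] (ν : Measure (X × Y)) :
    ℝ≥0∞ :=
  InformationTheory.klDiv ν (ν.fst.prod ν.snd)

/-- Conditional mutual information `I(X;Y∣S) = E_{S ∼ μ} I(X;Y∣S=s)`, where `κ s` is the
conditional law of `(X, Y)` given `S = s`. -/
def condMutualInfo {S X Y : Type*} [MeasurableSpace S] [MeasurableSpace X] [MeasurableSpace Y]
    (μ : Measure S) (κ : Kernel S (X × Y)) : ℝ≥0∞ :=
  ∫⁻ s, mutualInfo (κ s) ∂μ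

/-! ### Modes of the demonstrated action distribution

`K s` is the number of modes at the state `s`, and `C s 1, …, C s (K s)` are the mode sets at `s`
(the values of `C s` at other indices play no role). -/

/-- Distance between two sets, `inf_{b ∈ B, c ∈ C} d(b, c)`, equal to `∞` if one is empty. -/
def setDist {A : Type*} [PseudoEMetricSpace A] (B C : Set A) : ℝ≥0∞ :=
  ⨅ b ∈ B, ⨅ c ∈ C, edist b c

/-- The separation `Δ(s) = min_{k ≠ k'} dist (C_k(s), C_k'(s))`, equal to `∞` if `K s = 1`. -/
def modeSeparation {S A : Type*} [PseudoEMetricSpace A] (K : S → ℕ) (C : S → ℕ → Set A) (s : S) :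
    ℝ≥0∞ :=
  ⨅ k ∈ Finset.Icc 1 (K s), ⨅ k' ∈ Finset.Icc 1 (K s), ⨅ _ : k ≠ k', setDist (C s k) (C s k')

/-- For every state `s`, the sets `C s 1, …, C s (K s)` are finitely many, at least one,
well-separated sets that cover the support of the conditional action law `pAct s`; they depend
measurably on `s`. -/
structure IsModeFamily {S A : Type*} [MeasurableSpace S] [MetricSpace A] [MeasurableSpace A]
    (pAct : Kernel S A) (K : S → ℕ) (C : S → ℕ → Set A) : Prop where
  one_le : ∀ s, 1 ≤ K s
  covers : ∀ s, (pAct s).support ⊆ ⋃ k ∈ Finset.Icc 1 (K s), C s k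
  separated : ∀ s, 0 < modeSeparation K C s
  measurable_card : Measurable K
  measurableSet_graph : ∀ k, 1 ≤ k → MeasurableSet {x : S × A | k ≤ K x.1 ∧ x.2 ∈ C x.1 k}

/-- The mode assignment `g(a, s) = ∑_{k=1}^{K(s)} k · 1{a ∈ C_k(s)}`. -/
def modeAssign {S A : Type*} (K : S → ℕ) (C : S → ℕ → Set A) (a : A) (s : S) : ℕ :=
  ∑ k ∈ Finset.Icc 1 (K s), (C s k).indicator (fun _ => k) a

/-- The conditional law of the mode label `M = g(A, S)` given `S = s`. -/
def modeLaw {S A : Type*} [MeasurableSpace S] [MeasurableSpace A] (pAct : Kernel S A)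
    (K : S → ℕ) (C : S → ℕ → Set A) (s : S) : Measure ℕ :=
  (pAct s).map (fun a => modeAssign K C a s)

/-- The mode-recovery error `ρ(s) = Pr(f(Z, s) ∉ C_M(s) ∣ S = s)`, with `M = g(A, s)`.  Given
`S = s`, the law of `(A, Z)` is `(pAct ⊗ₖ q) s`, that is, `A ∼ pAct s` and `Z ∼ q(· ∣ A, s)`. -/
def modeError {S A Z : Type*} [MeasurableSpace S] [MeasurableSpace A] [MeasurableSpace Z]
    (pAct : Kernel S A) (K : S → ℕ) (C : S → ℕ → Set A) (q : Kernel (S × A) Z) (f : Z → S → A)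
    (s : S) : ℝ :=
  ((pAct ⊗ₖ q) s).real {x : A × Z | f x.2 s ∉ C s (modeAssign K C x.1 s)}

/-- The Fano correction `H_b(r) + r log (k - 1)`, taken to be zero for `k = 1`. -/
def fanoCorrection (r : ℝ) (k : ℕ) : ℝ :=
  if k = 1 then 0 else Real.binEntropy r + r * Real.log ((k : ℝ) - 1)

/-- The Fano-corrected bound
`B_ρ = E[H(M ∣ S)] - E[H_b(ρ(S)) + ρ(S) log (K(S) - 1)]`, where `S ∼ μ`.
Both expectations are of nonnegative functions when `ρ` has values in `[0, 1]` and `K ≥ 1`, so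
they are taken in `[0, ∞]`; the difference is an extended real number (the undefined difference
`∞ - ∞` is `-∞` here). -/
def fanoBound {S A : Type*} [MeasurableSpace S] [MeasurableSpace A] (μ : Measure S)
    (pAct : Kernel S A) (K : S → ℕ) (C : S → ℕ → Set A) (ρ : S → ℝ) : EReal :=
  ((∫⁻ s, shannonEntropy (modeLaw pAct K C s) ∂μ : ℝ≥0∞) : EReal)
    - ((∫⁻ s, ENNReal.ofReal (fanoCorrection (ρ s) (K s)) ∂μ : ℝ≥0∞) : EReal)

end

end ModeInfo

/-!
Fix a state `s`, and let `ν` be the law of `(A, Z)` given `S = s`, with `n` modes, label `M`, law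
`π` of the label, and error probability `r`.  Guess the label from `z` with weight `1 - r` on the
mode which contains the decoded action, and `r / (n - 1)` on the other modes.  Write `φ(m, z)` for
this weight.  The weights of a given `z` sum to at most one; when the decoded action lies in no
mode, this is the hypothesis `r ≤ 1 - 1 / n`.  Therefore `h(a, z) = φ(m(a), z) / π(m(a))` has
integral at most one against `P_A × p`, for *every* probability measure `p` on the latent space.
Gibbs' inequality (`ofReal_integral_log_le_klDiv`) gives
`KL(ν ‖ P_A × p) ≥ ∫ log h dν = H(M) - (H_b(r) + r log (n - 1))`, which is
`shannonEntropy_le_klDiv_add_fanoCorrection`.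

The two bounds are two choices of `p`, integrated over the states
(`IsModeFamily.fanoBound_le_lintegral_klDiv`).  With `p` the law of `Z` given `S = s`, the left-hand
side is the mutual information.  With `p` the conditional prior, it is the expected divergence of
the encoder from the prior, by the chain rule `klDiv_compProd_right`.

Integrating requires the error to be measurable in the state, which is proved from the joint
measurability of the modes.  It also requires the actions outside all modes and the states outside
the support to be negligible, which holds because both spaces are second countable.
-/

open InformationTheory

namespace ModeInfo

/-! ### Gibbs' inequality and the Kullback-Leibler divergence of kernels -/

/-- Gibbs' inequality: a subprobability density `h` with respect to `μ` bounds the divergence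
`klDiv ν μ` from below by `∫ log h ∂ν`.  It is `log u ≤ u - 1` for `u = h / (dν/dμ)`. -/
lemma ofReal_integral_log_le_klDiv {Ω : Type*} [MeasurableSpace Ω] {ν μ : Measure Ω}
    [IsProbabilityMeasure ν] [IsProbabilityMeasure μ] {h : Ω → ℝ} (h_nonneg : 0 ≤ h)
    (h_pos : ∀ᵐ x ∂ν, 0 < h x) (h_int : Integrable h μ) (h_le : ∫ x, h x ∂μ ≤ 1)
    (h_log : Integrable (fun x => Real.log (h x)) ν) :
    ENNReal.ofReal (∫ x, Real.log (h x) ∂ν) ≤ klDiv ν μ := by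
  by_cases hfin : ν ≪ μ ∧ Integrable (llr ν μ) ν
  swap
  · rw [klDiv_eq_top_iff.2 (by tauto)]
    exact le_top
  obtain ⟨hac, hllr⟩ := hfin
  rw [klDiv_of_ac_of_integrable hac hllr]
  refine ENNReal.ofReal_le_ofReal ?_
  simp only [probReal_univ, add_sub_cancel_right]
  set r : Ω → ℝ := fun x => (ν.rnDeriv μ x).toReal
  have hr : Measurable r := (Measure.measurable_rnDeriv ν μ).ennreal_toReal
  have hr_pos : ∀ᵐ x ∂ν, 0 < r x := by
    filter_upwards [Measure.rnDeriv_pos hac, hac.ae_le (Measure.rnDeriv_ne_top ν μ)] with x h0 htop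
    exact ENNReal.toReal_pos h0.ne' htop
  have hr_nonneg : ∀ x, 0 ≤ r x := fun x => ENNReal.toReal_nonneg
  -- only an inequality, as `h x / r x = 0` where `r x = 0`
  have hmul : ∀ x, r x * (h x / r x) ≤ h x := fun x => by
    rcases eq_or_ne (r x) 0 with h0 | h0
    · simpa [h0] using h_nonneg x
    · rw [mul_div_cancel₀ _ h0]
  have hmul_int : Integrable (fun x => r x • (h x / r x)) μ := by
    refine h_int.mono' ?_ (Filter.Eventually.of_forall fun x => ?_)
    · exact hr.aestronglyMeasurable.smul
        (h_int.aestronglyMeasurable.aemeasurable.div hr.aemeasurable).aestronglyMeasurable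
    · rw [Real.norm_of_nonneg]
      · exact hmul x
      · exact mul_nonneg (hr_nonneg x) (div_nonneg (h_nonneg x) (hr_nonneg x))
  have hdiv_int : Integrable (fun x => h x / r x) ν := (integrable_rnDeriv_smul_iff hac).1 hmul_int
  have hdiv : ∫ x, h x / r x ∂ν ≤ 1 := by
    rw [← integral_rnDeriv_smul hac]
    exact (integral_mono hmul_int h_int hmul).trans h_le
  have hle : ∀ᵐ x ∂ν, Real.log (h x) ≤ llr ν μ x + (h x / r x - 1) := by
    filter_upwards [h_pos, hr_pos] with x hx hrx
    have := Real.log_le_sub_one_of_pos (div_pos hx hrx)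
    rw [Real.log_div hx.ne' hrx.ne'] at this
    simp only [llr]
    linarith
  have hsub_int : Integrable (fun x => h x / r x - 1) ν := hdiv_int.sub (integrable_const 1)
  have := integral_mono_ae h_log (hllr.add hsub_int) hle
  rw [Pi.add_def, integral_add hllr hsub_int, integral_sub hdiv_int (integrable_const 1)] at this
  simp only [integral_const, probReal_univ, smul_eq_mul, mul_one] at this
  linarith

lemma measurable_klDiv {X Y : Type*} [MeasurableSpace X] [MeasurableSpace Y]
    [MeasurableSpace.CountableOrCountablyGenerated X Y] (κ η : Kernel X Y) [IsFiniteKernel κ]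
    [IsFiniteKernel η] : Measurable fun x => klDiv (κ x) (η x) := by
  classical
  have h : (fun x => klDiv (κ x) (η x)) = fun x => if κ x ≪ η x then
      ∫⁻ y, ENNReal.ofReal (klFun (κ.rnDeriv η x y).toReal) ∂η x else ∞ := by
    ext x
    rw [klDiv_eq_lintegral_klFun]
    congr 1
    refine lintegral_congr_ae ?_
    filter_upwards [Kernel.rnDeriv_eq_rnDeriv_measure (κ := κ) (η := η) (a := x)] with y hy
    rw [hy]
  rw [h]
  refine Measurable.ite (Kernel.measurableSet_absolutelyContinuous κ η) ?_ measurable_const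
  refine Measurable.lintegral_kernel_prod_right' (f := fun p : X × Y =>
    ENNReal.ofReal (klFun (κ.rnDeriv η p.1 p.2).toReal)) ?_
  exact (measurable_klFun.comp (Kernel.measurable_rnDeriv κ η).ennreal_toReal).ennreal_ofReal

/-- Integral form of the chain rule for the Kullback-Leibler divergence, when the two joint laws
have the same first marginal. -/
lemma klDiv_compProd_right {X Y : Type*} [MeasurableSpace X] [MeasurableSpace Y]
    [MeasurableSpace.CountableOrCountablyGenerated X Y] (μ : Measure X) [IsFiniteMeasure μ]
    (κ η : Kernel X Y) [IsFiniteKernel κ] [IsFiniteKernel η] :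
    klDiv (μ ⊗ₘ κ) (μ ⊗ₘ η) = ∫⁻ x, klDiv (κ x) (η x) ∂μ := by
  by_cases hac : ∀ᵐ x ∂μ, κ x ≪ η x
  swap
  · rw [klDiv_of_not_ac (by rwa [Measure.absolutelyContinuous_compProd_right_iff])]
    by_contra hfin
    refine hac ?_
    filter_upwards [ae_lt_top (measurable_klDiv κ η) (Ne.symm hfin)] with x hx
    exact (klDiv_ne_top_iff.1 hx.ne).1
  have hac' : μ ⊗ₘ κ ≪ μ ⊗ₘ η := Measure.absolutelyContinuous_compProd_right_iff.2 hac
  have hdens : Measurable fun p : X × Y => κ.rnDeriv η p.1 p.2 := Kernel.measurable_rnDeriv κ η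
  -- the jointly measurable density of the kernels is a density of the joint laws
  have hκ : μ ⊗ₘ κ = (μ ⊗ₘ η).withDensity fun p => κ.rnDeriv η p.1 p.2 := by
    ext s hs
    rw [withDensity_apply _ hs, ← lintegral_indicator hs,
      Measure.lintegral_compProd (hdens.indicator hs), Measure.compProd_apply hs]
    refine lintegral_congr_ae ?_
    filter_upwards [hac] with x hx
    rw [← Kernel.setLIntegral_rnDeriv hx (measurable_prodMk_left hs),
      ← lintegral_indicator (measurable_prodMk_left hs)]
    rfl
  have hrn : (μ ⊗ₘ κ).rnDeriv (μ ⊗ₘ η) =ᵐ[μ ⊗ₘ η] fun p => κ.rnDeriv η p.1 p.2 := by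
    conv_lhs => rw [hκ]
    exact Measure.rnDeriv_withDensity _ hdens
  rw [klDiv_eq_lintegral_klFun_of_ac hac']
  calc
    _ = ∫⁻ p, ENNReal.ofReal (klFun (κ.rnDeriv η p.1 p.2).toReal) ∂(μ ⊗ₘ η) := by
      refine lintegral_congr_ae ?_
      filter_upwards [hrn] with p hp
      rw [hp]
    _ = ∫⁻ x, ∫⁻ y, ENNReal.ofReal (klFun (κ.rnDeriv η x y).toReal) ∂η x ∂μ :=
      Measure.lintegral_compProd (measurable_klFun.comp hdens.ennreal_toReal).ennreal_ofReal
    _ = ∫⁻ x, klDiv (κ x) (η x) ∂μ := by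
      refine lintegral_congr_ae ?_
      filter_upwards [hac] with x hx
      rw [klDiv_eq_lintegral_klFun_of_ac hx]
      refine lintegral_congr_ae ?_
      filter_upwards [Kernel.rnDeriv_eq_rnDeriv_measure (κ := κ) (η := η) (a := x)] with y hy
      rw [hy]

/-! ### Fano's inequality -/

lemma shannonEntropy_eq_of_ae_mem {X : Type*} [MeasurableSpace X] {ν : Measure X}
    [IsProbabilityMeasure ν] (s : Finset X) (hs : ∀ᵐ k ∂ν, k ∈ s) :
    shannonEntropy ν = ENNReal.ofReal (∑ k ∈ s, Real.negMulLog (ν.real {k})) := by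
  rw [shannonEntropy, tsum_eq_sum (s := s), ENNReal.ofReal_sum_of_nonneg]
  · exact fun k _ => Real.negMulLog_nonneg measureReal_nonneg measureReal_le_one
  · intro k hk
    have h0 : ν {k} = 0 := measure_mono_null (by simpa using hk) (ae_iff.1 hs)
    simp [measureReal_def, h0]

lemma integrable_of_ae_mem_finset {X : Type*} [MeasurableSpace X] [MeasurableSingletonClass X]
    {μ : Measure X} [IsFiniteMeasure μ] {s : Finset X} (hs : ∀ᵐ x ∂μ, x ∈ s) (g : X → ℝ) :
    Integrable g μ := by
  rw [← Measure.restrict_eq_self_of_ae_mem (s := (s : Set X)) hs]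
  exact IntegrableOn.finset

lemma integral_eq_sum_of_ae_mem_finset {X : Type*} [MeasurableSpace X]
    [MeasurableSingletonClass X] {μ : Measure X} [IsFiniteMeasure μ] {s : Finset X}
    (hs : ∀ᵐ x ∂μ, x ∈ s) (g : X → ℝ) : ∫ x, g x ∂μ = ∑ x ∈ s, μ.real {x} * g x := by
  have := setIntegral_finset (μ := μ) (f := g) s IntegrableOn.finset
  rwa [Measure.restrict_eq_self_of_ae_mem (s := (s : Set X)) hs] at this

/-- At most one indicator of a disjoint family is nonzero at a given point. -/
lemma sum_indicator_const_le {ι Z : Type*} {s : Finset ι} {D : ι → Set Z}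
    (hD : (s : Set ι).PairwiseDisjoint D) {c : ℝ} (hc : 0 ≤ c) (z : Z) :
    ∑ k ∈ s, (D k).indicator (fun _ => c) z ≤ c := by
  have := congrFun (Finset.indicator_biUnion s D (f := fun _ : Z => c) hD) z
  rw [← this]
  exact Set.indicator_le_self' (fun _ _ => hc) z

/-- Fano's inequality for a decoder that outputs one of the disjoint events `D 1, …, D n`, or none of
them.  The law of the observation in the reference product law is arbitrary, it need not be the
second marginal of `ν`. -/
theorem shannonEntropy_le_klDiv_add_fanoCorrection {X Z : Type*} [MeasurableSpace X]
    [MeasurableSpace Z] (ν : Measure (X × Z)) [IsProbabilityMeasure ν] (p : Measure Z)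
    [IsProbabilityMeasure p] {n : ℕ} (hn : 1 ≤ n) {m : X → ℕ} (hm : Measurable m)
    (hmem : ∀ᵐ x ∂ν.fst, m x ∈ Finset.Icc 1 n) {D : ℕ → Set Z}
    (hD : ∀ k, MeasurableSet (D k)) (hdisj : (Finset.Icc 1 n : Set ℕ).PairwiseDisjoint D)
    (hr : 1 < n → ν.real {x | x.2 ∉ D (m x.1)} ≤ 1 - 1 / (n : ℝ)) :
    shannonEntropy (ν.fst.map m) ≤ klDiv ν (ν.fst.prod p) +
      ENNReal.ofReal (fanoCorrection (ν.real {x | x.2 ∉ D (m x.1)}) n) := by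
  set P := ν.fst with hP
  set Q := P.map m with hQ
  set π : ℕ → ℝ := fun k => Q.real {k} with hπ
  have hQprob : IsProbabilityMeasure Q := Measure.isProbabilityMeasure_map hm.aemeasurable
  have hQmem : ∀ᵐ k ∂Q, k ∈ Finset.Icc 1 n :=
    (ae_map_iff hm.aemeasurable (MeasurableSet.of_discrete (s := {k | k ∈ Finset.Icc 1 n}))).2 hmem
  have hQint := fun g : ℕ → ℝ => integrable_of_ae_mem_finset hQmem g
  have hQsum := fun g : ℕ → ℝ => integral_eq_sum_of_ae_mem_finset hQmem g
  rw [shannonEntropy_eq_of_ae_mem (Finset.Icc 1 n) hQmem]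
  -- for a single label the left-hand side vanishes
  rcases hn.eq_or_lt with rfl | hn1
  · have : Q.real {1} = 1 := by simpa using (hQsum fun _ => 1).symm
    simp [this]
  have hn0 : (1 : ℝ) < n := by exact_mod_cast hn1
  have hr := hr hn1
  set E : Set (X × Z) := {x | x.2 ∈ D (m x.1)} with hE
  have hEeq : E = ⋃ k, {x : X × Z | m x.1 = k ∧ x.2 ∈ D k} := by
    ext x; simp [hE]
  have hEmeas : MeasurableSet E := by
    rw [hEeq]
    exact MeasurableSet.iUnion fun k =>
      ((hm.comp measurable_fst) (MeasurableSet.singleton k)).inter (measurable_snd (hD k))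
  change ν.real Eᶜ ≤ _ at hr
  change _ ≤ _ + ENNReal.ofReal (fanoCorrection (ν.real Eᶜ) n)
  set r := ν.real Eᶜ with hrdef
  have hr0 : 0 ≤ r := measureReal_nonneg
  have hr1 : 0 < 1 - r := by
    have : 0 < 1 / (n : ℝ) := by positivity
    linarith
  set t := r / ((n : ℝ) - 1) with ht
  have hn1' : 0 < (n : ℝ) - 1 := by linarith
  have ht0 : 0 ≤ t := div_nonneg hr0 hn1'.le
  have htr : ((n : ℝ) - 1) * t = r := by rw [ht]; field_simp
  have htle : t ≤ 1 - r := by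
    have h1 : t ≤ 1 / (n : ℝ) := by
      rw [ht, div_le_iff₀ hn1']
      calc r ≤ 1 - 1 / (n : ℝ) := hr
        _ = 1 / (n : ℝ) * (n - 1) := by field_simp
    linarith
  -- `φ · z` is the guess of the label made from `z`: weight `1 - r` on the decoded label and `t` on
  -- the others.  If nothing is decoded, its total mass is `n * t`, which is at most `1` exactly when
  -- `r ≤ 1 - 1 / n`.
  set φ : ℕ → Z → ℝ := fun k z => t + (D k).indicator (fun _ => 1 - r - t) z with hφ
  have hφ0 : ∀ k z, 0 ≤ φ k z := fun k z =>
    add_nonneg ht0 (Set.indicator_nonneg (fun _ _ => by linarith) z)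
  have hφsum : ∀ z, ∑ k ∈ Finset.Icc 1 n, φ k z ≤ 1 := fun z => by
    have := sum_indicator_const_le hdisj (c := 1 - r - t) (by linarith) z
    simp only [hφ, Finset.sum_add_distrib, Finset.sum_const, Nat.card_Icc, nsmul_eq_mul,
      Nat.add_sub_cancel]
    linarith
  have hφint : ∀ k, Integrable (φ k) p := fun k =>
    (integrable_const t).add ((integrable_const _).indicator (hD k))
  -- the density for Gibbs' inequality is `φ (m x) z / π (m x)`, as a finite sum of products
  set w : ℕ → X → ℝ := fun k x => (m ⁻¹' {k}).indicator (fun _ => (π k)⁻¹) x with hw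
  have hwint : ∀ k, Integrable (w k) P := fun k =>
    (integrable_const _).indicator (hm (MeasurableSet.singleton k))
  have hw_integral : ∀ k, ∫ x, w k x ∂P ≤ 1 := fun k => by
    rw [hw]
    simp only
    rw [integral_indicator_const _ (hm (MeasurableSet.singleton k)), smul_eq_mul]
    have : P.real (m ⁻¹' {k}) = π k := by
      rw [hπ, hQ]; simp only
      rw [map_measureReal_apply hm (MeasurableSet.singleton k)]
    rw [this]
    -- `≤` and not `=`, as `π k` may be zero
    exact mul_inv_le_one
  set h : X × Z → ℝ := fun x => ∑ k ∈ Finset.Icc 1 n, w k x.1 * φ k x.2 with hh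
  have hw0 : ∀ k x, 0 ≤ w k x := fun k x =>
    Set.indicator_nonneg (fun _ _ => inv_nonneg.2 measureReal_nonneg) x
  have h_nonneg : 0 ≤ h := fun x => Finset.sum_nonneg fun k _ => mul_nonneg (hw0 _ _) (hφ0 _ _)
  have h_term : ∀ k, Integrable (fun x : X × Z => w k x.1 * φ k x.2) (P.prod p) :=
    fun k => (hwint k).mul_prod (hφint k)
  have h_int : Integrable h (P.prod p) := integrable_finsetSum _ fun k _ => h_term k
  have h_le : ∫ x, h x ∂(P.prod p) ≤ 1 := by
    rw [hh, integral_finsetSum _ fun k _ => h_term k]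
    calc ∑ k ∈ Finset.Icc 1 n, ∫ x, w k x.1 * φ k x.2 ∂(P.prod p)
        = ∑ k ∈ Finset.Icc 1 n, (∫ x, w k x ∂P) * ∫ z, φ k z ∂p :=
          Finset.sum_congr rfl fun k _ => integral_prod_mul _ _
      _ ≤ ∑ k ∈ Finset.Icc 1 n, ∫ z, φ k z ∂p := Finset.sum_le_sum fun k _ =>
          mul_le_of_le_one_left (integral_nonneg (hφ0 k)) (hw_integral k)
      _ = ∫ z, ∑ k ∈ Finset.Icc 1 n, φ k z ∂p := (integral_finsetSum _ fun k _ => hφint k).symm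
      _ ≤ ∫ _, (1 : ℝ) ∂p := integral_mono (integrable_finsetSum _ fun k _ => hφint k)
          (integrable_const 1) hφsum
      _ = 1 := by simp
  have hmp : MeasurePreserving (fun x : X × Z => m x.1) ν Q :=
    ⟨hm.comp measurable_fst, by rw [hQ, hP, Measure.fst, Measure.map_map hm measurable_fst]; rfl⟩
  have hν_mem : ∀ᵐ x ∂ν, m x.1 ∈ Finset.Icc 1 n := hmp.quasiMeasurePreserving.ae hQmem
  have hν_pos : ∀ᵐ x ∂ν, 0 < π (m x.1) := by
    refine hmp.quasiMeasurePreserving.ae (p := fun k => 0 < π k) ?_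
    rw [ae_iff, ← Set.biUnion_of_singleton {k | ¬ 0 < π k}]
    refine (measure_biUnion_null_iff (Set.to_countable _)).2 fun k hk => ?_
    have : π k = 0 := le_antisymm (not_lt.1 hk) measureReal_nonneg
    exact (measureReal_eq_zero_iff).1 this
  -- `t` vanishes only if errors have probability zero
  have hν_err : ∀ᵐ x ∂ν, x ∉ E → 0 < t := by
    rcases hr0.eq_or_lt with h0 | h0
    · have : ν Eᶜ = 0 := (measureReal_eq_zero_iff).1 h0.symm
      filter_upwards [compl_mem_ae_iff.2 this] with x hx hx'
      exact absurd hx' hx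
    · exact Filter.Eventually.of_forall fun _ _ => div_pos h0 hn1'
  -- `ν`-almost everywhere, only the summand `k = m x.1` of `h` survives
  have hval : ∀ᵐ x ∂ν, 0 < h x ∧ Real.log (h x) = E.indicator (fun _ => Real.log (1 - r)) x +
      Eᶜ.indicator (fun _ => Real.log t) x - Real.log (π (m x.1)) := by
    filter_upwards [hν_mem, hν_pos, hν_err] with x hx hpos herr
    have hhx : h x = (π (m x.1))⁻¹ * φ (m x.1) x.2 := by
      rw [hh]; simp only
      rw [Finset.sum_eq_single (m x.1)]
      · simp [hw]
      · intro k _ hk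
        rw [hw]
        simp [Ne.symm hk]
      · exact fun hx' => absurd hx hx'
    by_cases hxE : x ∈ E
    · have hφx : φ (m x.1) x.2 = 1 - r := by
        have : x.2 ∈ D (m x.1) := hxE
        simp [hφ, this]
      rw [hhx, hφx, Real.log_mul (inv_pos.2 hpos).ne' hr1.ne', Real.log_inv]
      refine ⟨mul_pos (inv_pos.2 hpos) hr1, ?_⟩
      simp [hxE]
      ring
    · have hφx : φ (m x.1) x.2 = t := by
        have : x.2 ∉ D (m x.1) := hxE
        simp [hφ, this]
      rw [hhx, hφx, Real.log_mul (inv_pos.2 hpos).ne' (herr hxE).ne', Real.log_inv]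
      refine ⟨mul_pos (inv_pos.2 hpos) (herr hxE), ?_⟩
      simp [hxE]
      ring
  have hlog_eq := hval.mono fun x hx => hx.2
  have hi1 : Integrable (E.indicator fun _ => Real.log (1 - r)) ν :=
    (integrable_const _).indicator hEmeas
  have hi2 : Integrable (Eᶜ.indicator fun _ => Real.log t) ν :=
    (integrable_const _).indicator hEmeas.compl
  have hi3 : Integrable (fun x : X × Z => Real.log (π (m x.1))) ν :=
    hmp.integrable_comp_of_integrable (hQint fun k => Real.log (π k))
  have hi3' : ∫ x : X × Z, Real.log (π (m x.1)) ∂ν =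
      ∑ k ∈ Finset.Icc 1 n, π k * Real.log (π k) := by
    rw [← (hQsum fun k => Real.log (π k)), ← hmp.map_eq,
      integral_map hmp.measurable.aemeasurable (measurable_from_nat).aestronglyMeasurable]
  have h_log : Integrable (fun x => Real.log (h x)) ν :=
    ((hi1.add hi2).sub hi3).congr (hlog_eq.mono fun x hx => hx.symm)
  have hfano : fanoCorrection r n = - ((1 - r) * Real.log (1 - r) + r * Real.log t) := by
    rw [fanoCorrection, if_neg hn1.ne', Real.binEntropy_eq_negMulLog_add_negMulLog_one_sub]
    rcases hr0.eq_or_lt with h0 | h0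
    · simp [← h0]
    · rw [ht, Real.log_div h0.ne' hn1'.ne', Real.negMulLog, Real.negMulLog]
      ring
  have hintegral : ∫ x, Real.log (h x) ∂ν =
      ∑ k ∈ Finset.Icc 1 n, Real.negMulLog (π k) - fanoCorrection r n := by
    have hi12 : Integrable (fun x => E.indicator (fun _ => Real.log (1 - r)) x +
        Eᶜ.indicator (fun _ => Real.log t) x) ν := hi1.add hi2
    rw [integral_congr_ae hlog_eq, integral_sub hi12 hi3, integral_add hi1 hi2,
      integral_indicator_const _ hEmeas, integral_indicator_const _ hEmeas.compl, hi3', hfano,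
      ← hrdef]
    have hEr : ν.real E = 1 - r := by
      rw [hrdef, probReal_compl_eq_one_sub hEmeas]; ring
    rw [hEr]
    simp only [Real.negMulLog, smul_eq_mul, neg_mul, Finset.sum_neg_distrib]
    ring
  have hgibbs := ofReal_integral_log_le_klDiv (ν := ν) (μ := P.prod p) h_nonneg
    (hval.mono fun x hx => hx.1) h_int h_le h_log
  rw [hintegral] at hgibbs
  calc ENNReal.ofReal (∑ k ∈ Finset.Icc 1 n, Real.negMulLog (π k))
      = ENNReal.ofReal ((∑ k ∈ Finset.Icc 1 n, Real.negMulLog (π k) - fanoCorrection r n) +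
          fanoCorrection r n) := by rw [sub_add_cancel]
    _ ≤ _ := ENNReal.ofReal_add_le.trans (by gcongr)

/-! ### Mode families: disjointness, labels and measurability -/

/-- The mode sets with the values at the irrelevant indices, those outside `1, …, K s`, replaced
by the empty set.  Unlike `C`, this family is measurable at every index. -/
def trimmedMode {S A : Type*} (K : S → ℕ) (C : S → ℕ → Set A) (s : S) (k : ℕ) : Set A :=
  {a | k ∈ Finset.Icc 1 (K s) ∧ a ∈ C s k}

lemma trimmedMode_of_mem {S A : Type*} {K : S → ℕ} (C : S → ℕ → Set A) {s : S} {k : ℕ}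
    (hk : k ∈ Finset.Icc 1 (K s)) : trimmedMode K C s k = C s k := by
  ext a
  simp only [trimmedMode, Set.mem_ofPred_eq, hk, true_and]

lemma fst_compProd_apply {S A Z : Type*} [MeasurableSpace S] [MeasurableSpace A]
    [MeasurableSpace Z] (κ : Kernel S A) [IsMarkovKernel κ] (q : Kernel (S × A) Z)
    [IsMarkovKernel q] (s : S) : ((κ ⊗ₖ q) s).fst = κ s := by
  rw [Measure.fst, ← Kernel.fst_apply, Kernel.fst_compProd]

namespace IsModeFamily

variable {S A : Type*} [MeasurableSpace S] [MetricSpace A] [MeasurableSpace A]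
  {pAct : Kernel S A} {K : S → ℕ} {C : S → ℕ → Set A}

lemma pairwiseDisjoint (h : IsModeFamily pAct K C) (s : S) :
    (Finset.Icc 1 (K s) : Set ℕ).PairwiseDisjoint (C s) := by
  intro k hk k' hk' hkk'
  refine Set.disjoint_left.2 fun a ha ha' => (h.separated s).ne' ?_
  have h1 : modeSeparation K C s ≤ edist a a :=
    (iInf₂_le k hk).trans <| (iInf₂_le k' hk').trans <| (iInf_le _ hkk').trans <|
      (iInf₂_le a ha).trans <| iInf₂_le a ha'
  simpa using h1

lemma modeAssign_eq (h : IsModeFamily pAct K C) {s : S} {k : ℕ} (hk : k ∈ Finset.Icc 1 (K s))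
    {a : A} (ha : a ∈ C s k) : modeAssign K C a s = k := by
  rw [modeAssign, Finset.sum_eq_single k]
  · simp [ha]
  · intro j hj hjk
    exact Set.indicator_of_notMem
      (Set.disjoint_right.1 (h.pairwiseDisjoint s hj hk hjk) ha) _
  · exact fun hk' => absurd hk hk'

/-- Since the modes are disjoint, the sum defining the label has at most one nonzero term. -/
lemma modeAssign_eq_iff (h : IsModeFamily pAct K C) {s : S} {k : ℕ} (hk : k ≠ 0) {a : A} :
    modeAssign K C a s = k ↔ a ∈ trimmedMode K C s k := by
  refine ⟨fun hak => ?_, fun ha => h.modeAssign_eq ha.1 ha.2⟩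
  by_cases hex : ∃ j ∈ Finset.Icc 1 (K s), a ∈ C s j
  · obtain ⟨j, hj, haj⟩ := hex
    obtain rfl := (h.modeAssign_eq hj haj).symm.trans hak
    exact ⟨hj, haj⟩
  · refine absurd (hak.symm.trans ?_) hk
    exact Finset.sum_eq_zero fun j hj =>
      Set.indicator_of_notMem (fun haj => hex ⟨j, hj, haj⟩) _

lemma measurableSet_trimmedMode_graph (h : IsModeFamily pAct K C) (k : ℕ) :
    MeasurableSet {x : S × A | x.2 ∈ trimmedMode K C x.1 k} := by
  rcases Nat.eq_zero_or_pos k with rfl | hk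
  · simp [trimmedMode]
  · convert h.measurableSet_graph k hk using 3
    simp [trimmedMode, Nat.one_le_iff_ne_zero, hk.ne']

lemma measurableSet_trimmedMode (h : IsModeFamily pAct K C) (s : S) (k : ℕ) :
    MeasurableSet (trimmedMode K C s k) :=
  measurable_prodMk_left (h.measurableSet_trimmedMode_graph k)

lemma measurable_modeAssign (h : IsModeFamily pAct K C) :
    Measurable fun x : S × A => modeAssign K C x.2 x.1 := by
  have hpos : ∀ k ≠ 0, MeasurableSet ((fun x : S × A => modeAssign K C x.2 x.1) ⁻¹' {k}) := by
    intro k hk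
    convert h.measurableSet_trimmedMode_graph k using 1
    ext x
    exact h.modeAssign_eq_iff hk
  refine measurable_to_countable' fun k => ?_
  rcases eq_or_ne k 0 with rfl | hk
  · have : (fun x : S × A => modeAssign K C x.2 x.1) ⁻¹' {0} =
        (⋃ k : {k : ℕ // k ≠ 0}, (fun x : S × A => modeAssign K C x.2 x.1) ⁻¹' {k.1})ᶜ := by
      ext x
      simp only [Set.mem_preimage, Set.mem_singleton_iff, Set.mem_compl_iff, Set.mem_iUnion,
        Subtype.exists, exists_prop, exists_eq_right', not_not, ne_eq]
    rw [this]
    exact (MeasurableSet.iUnion fun k : {k : ℕ // k ≠ 0} => hpos k.1 k.2).compl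
  · exact hpos k hk

/-- In a second-countable space the support has full measure, so almost every action lies in a
mode and gets a label in `1, …, K s`. -/
lemma ae_modeAssign_mem [SecondCountableTopology A] (h : IsModeFamily pAct K C) (s : S) :
    ∀ᵐ a ∂pAct s, modeAssign K C a s ∈ Finset.Icc 1 (K s) := by
  filter_upwards [Measure.support_mem_ae (μ := pAct s)] with a ha
  obtain ⟨k, hk, hak⟩ := Set.mem_iUnion₂.1 (h.covers s ha)
  rwa [h.modeAssign_eq hk hak]

variable {Z : Type*} [MeasurableSpace Z] [IsMarkovKernel pAct] {q : Kernel (S × A) Z}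
  [IsMarkovKernel q]

/-- The label `0` of an action outside all modes has probability zero, so the arbitrary set `C s 0`
does not contribute to the error. -/
lemma modeError_eq [SecondCountableTopology A] (h : IsModeFamily pAct K C) (f : Z → S → A)
    (s : S) : modeError pAct K C q f s =
      ((pAct ⊗ₖ q) s).real {x | f x.2 s ∉ trimmedMode K C s (modeAssign K C x.1 s)} := by
  refine measureReal_congr ?_
  have hmem : ∀ᵐ x ∂(pAct ⊗ₖ q) s, modeAssign K C x.1 s ∈ Finset.Icc 1 (K s) :=
    ae_of_ae_map measurable_fst.aemeasurable (by
      change ∀ᵐ a ∂((pAct ⊗ₖ q) s).fst, _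
      rw [fst_compProd_apply]
      exact h.ae_modeAssign_mem s)
  filter_upwards [hmem] with x hx
  change (f x.2 s ∉ C s _) = (f x.2 s ∉ trimmedMode K C s _)
  rw [trimmedMode_of_mem C hx]

lemma measurable_modeError [SecondCountableTopology A] (h : IsModeFamily pAct K C)
    {f : Z → S → A} (hf : Measurable (Function.uncurry f)) :
    Measurable (modeError pAct K C q f) := by
  rw [funext (h.modeError_eq f)]
  have hE : MeasurableSet {y : S × A × Z |
      f y.2.2 y.1 ∉ trimmedMode K C y.1 (modeAssign K C y.2.1 y.1)} := by
    have : {y : S × A × Z | f y.2.2 y.1 ∉ trimmedMode K C y.1 (modeAssign K C y.2.1 y.1)} =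
        (⋃ k, {y : S × A × Z | modeAssign K C y.2.1 y.1 = k ∧
          f y.2.2 y.1 ∈ trimmedMode K C y.1 k})ᶜ := by
      ext y
      simp
    rw [this]
    refine (MeasurableSet.iUnion fun k => MeasurableSet.inter ?_ ?_).compl
    · exact (h.measurable_modeAssign.comp
        (measurable_fst.prodMk (measurable_fst.comp measurable_snd))) (MeasurableSet.singleton k)
    · exact (measurable_fst.prodMk (hf.comp ((measurable_snd.comp measurable_snd).prodMk
        measurable_fst))) (h.measurableSet_trimmedMode_graph k)
  exact (Kernel.measurable_kernel_prodMk_left hE).ennreal_toReal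

end IsModeFamily

/-! ### Averaging over the states -/

lemma measurable_fanoCorrection {S : Type*} [MeasurableSpace S] {r : S → ℝ} {K : S → ℕ}
    (hr : Measurable r) (hK : Measurable K) : Measurable fun s => fanoCorrection (r s) (K s) := by
  refine Measurable.ite (hK (MeasurableSet.singleton 1)) measurable_const ?_
  have hK' : Measurable fun s => (K s : ℝ) := measurable_from_nat.comp hK
  exact (Real.binEntropy_continuous.measurable.comp hr).add
    (hr.mul (Real.measurable_log.comp (hK'.sub_const 1)))

/-- The state-wise Fano inequality, averaged over the states.  The reference law `p s` on the latent
space is arbitrary: the aggregated posterior gives the mutual information, and the conditional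
prior gives the expected divergence of the encoder from the prior. -/
theorem IsModeFamily.fanoBound_le_lintegral_klDiv {S A Z : Type*} [TopologicalSpace S]
    [SecondCountableTopology S] [MeasurableSpace S] [BorelSpace S] [MetricSpace A]
    [SecondCountableTopology A] [MeasurableSpace A] [BorelSpace A] [MeasurableSpace Z]
    (μ : Measure S) (pAct : Kernel S A) [IsMarkovKernel pAct] {K : S → ℕ} {C : S → ℕ → Set A}
    (h : IsModeFamily pAct K C) (q : Kernel (S × A) Z) [IsMarkovKernel q]
    (p : S → Measure Z) [∀ s, IsProbabilityMeasure (p s)]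
    {f : Z → S → A} (hf : Measurable (Function.uncurry f))
    (hρ : ∀ s ∈ μ.support, 1 < K s → modeError pAct K C q f s ≤ 1 - 1 / (K s : ℝ)) :
    fanoBound μ pAct K C (modeError pAct K C q f) ≤
      ((∫⁻ s, klDiv ((pAct ⊗ₖ q) s) ((pAct s).prod (p s)) ∂μ : ℝ≥0∞) : EReal) := by
  -- no finiteness is needed here, as `∞ - ∞` is `⊥` in `EReal`
  refine EReal.sub_le_of_le_add ?_
  rw [← EReal.coe_ennreal_add, EReal.coe_ennreal_le_coe_ennreal_iff,
    ← lintegral_add_right _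
      (measurable_fanoCorrection (h.measurable_modeError hf) h.measurable_card).ennreal_ofReal]
  refine lintegral_mono_ae ?_
  filter_upwards [Measure.support_mem_ae (μ := μ)] with s hs
  have hfst := fst_compProd_apply pAct q s
  have := shannonEntropy_le_klDiv_add_fanoCorrection ((pAct ⊗ₖ q) s) (p s) (h.one_le s)
    (m := fun a => modeAssign K C a s) (D := fun k => {z | f z s ∈ trimmedMode K C s k})
    (h.measurable_modeAssign.comp measurable_prodMk_left)
    (by rw [hfst]; exact h.ae_modeAssign_mem s)
    (fun k => (hf.comp measurable_prodMk_right) (h.measurableSet_trimmedMode s k))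
    (fun k hk k' hk' hkk' => Set.disjoint_left.2 fun z hz hz' =>
      Set.disjoint_left.1 (h.pairwiseDisjoint s hk hk' hkk') hz.2 hz'.2)
    (fun hK => (h.modeError_eq f s).symm.trans_le (hρ s hs hK))
  rw [hfst] at this
  rw [h.modeError_eq f s]
  exact this

end ModeInfo

theorem proposition1
    {S A : Type*}
    -- the state space and the metric action space
    [TopologicalSpace S] [SecondCountableTopology S] [MeasurableSpace S] [BorelSpace S]
    [MetricSpace A] [SecondCountableTopology A] [MeasurableSpace A] [BorelSpace A]
    -- the demonstration law of `(S, A)` and its conditional action law given the state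
    (pD : Measure (S × A)) [IsProbabilityMeasure pD]
    (pAct : Kernel S A) [IsMarkovKernel pAct] [pD.IsCondKernel pAct]
    -- the modes
    (K : S → ℕ) (C : S → ℕ → Set A) (hmodes : ModeInfo.IsModeFamily pAct K C)
    -- posterior encoder, conditional prior and deterministic decoder
    (d : ℕ)
    (q : Kernel (S × A) (EuclideanSpace ℝ (Fin d))) [IsMarkovKernel q]
    (pPrior : Kernel S (EuclideanSpace ℝ (Fin d))) [IsMarkovKernel pPrior]
    (f : EuclideanSpace ℝ (Fin d) → S → A) (hf : Measurable (Function.uncurry f))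
    -- on the support of the state marginal, the error is no worse than random guessing
    (hρ : ∀ s ∈ pD.fst.support, 1 < K s →
      ModeInfo.modeError pAct K C q f s ≤ 1 - 1 / (K s : ℝ)) :
    ModeInfo.fanoBound pD.fst pAct K C (ModeInfo.modeError pAct K C q f)
        ≤ ((ModeInfo.condMutualInfo pD.fst (pAct ⊗ₖ q) : ℝ≥0∞) : EReal) ∧
      ModeInfo.fanoBound pD.fst pAct K C (ModeInfo.modeError pAct K C q f)
        ≤ ((∫⁻ x, InformationTheory.klDiv (q x) (pPrior x.1) ∂pD : ℝ≥0∞) : EReal) := by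
  constructor
  · have := hmodes.fanoBound_le_lintegral_klDiv pD.fst pAct q
      (fun s => ((pAct ⊗ₖ q) s).snd) hf hρ
    simpa only [ModeInfo.condMutualInfo, ModeInfo.mutualInfo, ModeInfo.fst_compProd_apply]
      using this
  · have hmeas : Measurable fun x : S × A => InformationTheory.klDiv (q x) (pPrior x.1) :=
      ModeInfo.measurable_klDiv q (pPrior.prodMkRight A)
    have hkl : ∀ s, InformationTheory.klDiv ((pAct ⊗ₖ q) s) ((pAct s).prod (pPrior s)) =
        ∫⁻ a, InformationTheory.klDiv (q (s, a)) (pPrior s) ∂pAct s := fun s => by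
      rw [Kernel.compProd_apply_eq_compProd_sectR, ← Measure.compProd_const,
        ModeInfo.klDiv_compProd_right]
      simp
    have := hmodes.fanoBound_le_lintegral_klDiv pD.fst pAct q (fun s => pPrior s) hf hρ
    rw [← pD.disintegrate pAct, Measure.lintegral_compProd hmeas]
    rw [Measure.fst_compProd]
    simpa only [hkl] using this
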